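/- An abstract polyhedron $\mathcal P$ is a partially ordered set with a strictly increasing rank function to $\{0,1,2\}$ (elements of rank $0,1,2$ are called vertices, edges and faces; two elements are incident if they are comparable) such that: every edge is incident to exactly two vertices and exactly two faces; whenever a vertex and a face are incident, exactly two edges are incident to both; the graph of the incidence relation is connected; and for each vertex or face $F$ the subgraph of this graph induced by the neighbours of $F$ is connected (connected graphs are non-empty). A flag is a triple of a vertex, an edge and a face that are mutually incident; for a flag $\Phi$ and $i\in\{0,1,2\}$, $\Phi^i$ is the unique flag that differs from $\Phi$ exactly in its element of rank $i$, and $\Phi,\Phi^i$ are called adjacent. $\mathcal P$ is of type $\{p,q\}$, for natural numbers $p,q$, if every face is incident to exactly $p$ edges and every vertex is incident to exactly $q$ edges, and it is then tight if it has exactly $2pq$ flags. $\mathcal P$ is chiral if its automorphism group (the group of order-preserving bijections of $\mathcal P$ with order-preserving inverse) has exactly two orbits on flags and adjacent flags always lie in different orbits. For a chiral polyhedron and a base flag $\Phi$, let $\sigma_1$ and $\sigma_2$ be the unique automorphisms sending $\Phi$ to $(\Phi^1)^0$ and to $(\Phi^2)^1$, respectively, and let $\Gamma^+(\mathcal P)=\langle\sigma_1,\sigma_2\rangle$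 be the rotation group. Theorem. Let $\mathcal P$ be a tight chiral polyhedron of type $\{p,q\}$ with $q$ odd. Then $p$ is even and $p$ divides $2q$. Furthermore, for any choice of base flag, if $\langle\sigma_2\rangle$ is core-free in $\Gamma^+(\mathcal P)$ (that is, the only subgroup of $\langle\sigma_2\rangle$ that is normal in $\Gamma^+(\mathcal P)$ is the trivial one), then $p=2q$. -/

import Mathlib

/-- Two elements of a partially ordered set are incident if they are comparable. -/
def Incident {P : Type*} [PartialOrder P] (x y : P) : Prop := x ≤ y ∨ y ≤ x

/-- The graph of the incidence relation: distinct incident elements are joined by an edge. -/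
def incidenceGraph (P : Type*) [PartialOrder P] : SimpleGraph P where
  Adj x y := x ≠ y ∧ Incident x y
  symm := ⟨fun _ _ h => ⟨h.1.symm, h.2.symm⟩⟩
  loopless := ⟨fun _ h => h.1 rfl⟩

/-- The structure of an abstract polyhedron on a partially ordered set `P`: a rank function with
values `0` (vertices), `1` (edges), `2` (faces), subject to the usual axioms.
(`SimpleGraph.Connected` includes non-emptiness.) -/
structure AbstractPolyhedron (P : Type*) [PartialOrder P] where
  /-- the rank of an element -/
  rank : P → Fin 3
  rank_strictMono : StrictMono rank
  /-- every edge is incident to exactly two vertices -/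
  edge_vertices : ∀ e, rank e = 1 → {v | rank v = 0 ∧ Incident v e}.encard = 2
  /-- every edge is incident to exactly two faces -/
  edge_faces : ∀ e, rank e = 1 → {f | rank f = 2 ∧ Incident f e}.encard = 2
  /-- a vertex and a face that are incident have exactly two edges incident to both -/
  diamond : ∀ v f, rank v = 0 → rank f = 2 → Incident v f →
    {e | rank e = 1 ∧ Incident e v ∧ Incident e f}.encard = 2
  /-- the incidence graph is connected -/
  connected : (incidenceGraph P).Connected
  /-- the neighbours of any vertex or face induce a connected subgraph -/
  link_connected : ∀ x, rank x = 0 ∨ rank x = 2 →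
    ((incidenceGraph P).induce ((incidenceGraph P).neighborSet x)).Connected

namespace AbstractPolyhedron

variable {P : Type*} [PartialOrder P]

/-- A flag: a vertex `elt 0`, an edge `elt 1` and a face `elt 2`, mutually incident. -/
@[ext]
structure Flag (K : AbstractPolyhedron P) where
  /-- the element of each rank -/
  elt : Fin 3 → P
  rank_elt : ∀ i, K.rank (elt i) = i
  incident : ∀ i j, Incident (elt i) (elt j)

/-- `Ψ` is the flag `Φⁱ`: it differs from `Φ` in its element of rank `i`, and only there. -/
def Flag.AdjacentAt {K : AbstractPolyhedron P} (i : Fin 3) (Φ Ψ : K.Flag) : Prop :=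
  ∀ j, Φ.elt j ≠ Ψ.elt j ↔ j = i

/-- The automorphism `φ` sends the flag `Φ` to the flag `Ψ`. -/
def Flag.Sends {K : AbstractPolyhedron P} (φ : P ≃o P) (Φ Ψ : K.Flag) : Prop :=
  ∀ i, φ (Φ.elt i) = Ψ.elt i

/-- `K` has Schläfli symbol `{p, q}`: every face is a `p`-gon (it is incident to `p` edges) and
every vertex-figure is a `q`-gon (every vertex is incident to `q` edges). -/
def HasType (K : AbstractPolyhedron P) (p q : ℕ) : Prop :=
  (∀ f, K.rank f = 2 → {e | K.rank e = 1 ∧ Incident e f}.encard = p) ∧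
  (∀ v, K.rank v = 0 → {e | K.rank e = 1 ∧ Incident e v}.encard = q)

/-- `K` is a tight polyhedron of type `{p, q}`: it is of this type and has exactly `2pq` flags. -/
def IsTightOfType (K : AbstractPolyhedron P) (p q : ℕ) : Prop :=
  K.HasType p q ∧ ENat.card K.Flag = ((2 * p * q : ℕ) : ℕ∞)

/-- `K` is chiral: the flags fall into two classes (`C` and its complement) which are the orbits
of the automorphism group, which is not transitive on all flags, and adjacent flags lie in
different classes. -/
def IsChiral (K : AbstractPolyhedron P) : Prop :=
  ∃ C : Set K.Flag,
    (∀ Φ Ψ : K.Flag, (∃ φ : P ≃o P, Flag.Sends φ Φ Ψ) ↔ (Φ ∈ C ↔ Ψ ∈ C)) ∧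
    (¬ ∀ Φ Ψ : K.Flag, ∃ φ : P ≃o P, Flag.Sends φ Φ Ψ) ∧
    (∀ (i : Fin 3) (Φ Ψ : K.Flag), Flag.AdjacentAt i Φ Ψ → (Φ ∈ C ↔ Ψ ∉ C))

/-- `σ` sends the flag `Φ` to `(Φⁱ)ʲ`. -/
def SendsToAdjAdj (K : AbstractPolyhedron P) (Φ : K.Flag) (i j : Fin 3) (σ : P ≃o P) : Prop :=
  ∃ Ψ Ω : K.Flag, Flag.AdjacentAt i Φ Ψ ∧ Flag.AdjacentAt j Ψ Ω ∧ Flag.Sends σ Φ Ω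

/-- `σ₁`, `σ₂` are the distinguished generators of the rotation group for the base flag `Φ`:
`σ₁` sends `Φ` to `(Φ¹)⁰` and `σ₂` sends `Φ` to `(Φ²)¹`. -/
def IsDistinguishedPair (K : AbstractPolyhedron P) (Φ : K.Flag) (σ₁ σ₂ : P ≃o P) : Prop :=
  K.SendsToAdjAdj Φ 1 0 σ₁ ∧ K.SendsToAdjAdj Φ 2 1 σ₂

end AbstractPolyhedron

/-- The rotation group generated by the two automorphisms `σ₁` and `σ₂`. -/
def rotationGroup {P : Type*} [PartialOrder P] (σ₁ σ₂ : P ≃o P) : Subgroup (P ≃o P) :=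
  Subgroup.closure {σ₁, σ₂}

/-- A subgroup is core-free if it contains no nontrivial normal subgroup of the whole group. -/
def IsCoreFree {G : Type*} [Group G] (H : Subgroup G) : Prop := H.normalCore = ⊥

/-! Automorphisms act freely on flags, and chirality forbids sending a flag to an adjacent one, so
an automorphism fixing two elements of a flag is trivial. Hence `σ₁` and `σ₂` have orders p and q,
generate subgroups with trivial intersection, and have an involution as product. Two flag orbits and
2pq flags leave room for at most pq automorphisms, so the rotation group factors as `⟨σ₁⟩⟨σ₂⟩`.

The rest is group theory. Let G = AB with A = ⟨a⟩, B = ⟨b⟩, b of odd order and t = ab satisfying t²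
= 1. Counting cosets gives z ≠ 1 in B whose conjugate by t commutes with b (`exists_commute_conj`).
Then z and its conjugate generate an abelian normal subgroup of order dividing |z|², and induction
on the quotient gives |G| ∣ 2|b|² (`card_dvd_two_mul_orderOf_sq`). With |G| = pq this reads p ∣ 2q;
p is even because a group of odd order has no involution. If B is core-free, then B meets its
conjugate by a trivially, so q ≤ p, and parity leaves only p = 2q. -/

section CyclicFactorization

variable {G : Type*} [Group G]

/-! ### Cyclic subgroups and coset counting -/

/-- A finite cyclic group has one subgroup of each order, so inclusion of subgroups is divisibility
of orders. -/
theorem mem_zpowers_of_orderOf_dvd [Finite G] {a x y : G}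
    (hx : x ∈ Subgroup.zpowers a) (hy : y ∈ Subgroup.zpowers a)
    (h : orderOf y ∣ orderOf x) : y ∈ Subgroup.zpowers x := by
  obtain ⟨m, rfl⟩ := mem_powers_iff_mem_zpowers.2 hx
  obtain ⟨k, rfl⟩ := mem_powers_iff_mem_zpowers.2 hy
  simp only at h ⊢
  rw [orderOf_pow, orderOf_pow] at h
  have hn : 0 < orderOf a := orderOf_pos a
  obtain ⟨n', hn'⟩ := Nat.gcd_dvd_left (orderOf a) m
  obtain ⟨n'', hn''⟩ := Nat.gcd_dvd_left (orderOf a) k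
  have hd : 0 < (orderOf a).gcd m := Nat.gcd_pos_of_pos_left _ hn
  have he : 0 < (orderOf a).gcd k := Nat.gcd_pos_of_pos_left _ hn
  rw [Nat.div_eq_of_eq_mul_right he hn'', Nat.div_eq_of_eq_mul_right hd hn'] at h
  obtain ⟨c, rfl⟩ := h
  have h0 : 0 < n'' := Nat.pos_of_ne_zero (by rintro rfl; omega)
  have hec : (orderOf a).gcd k = (orderOf a).gcd m * c :=
    Nat.eq_of_mul_eq_mul_right h0 (by rw [← hn'', mul_assoc, mul_comm c, ← hn'])
  have hdk : (orderOf a).gcd m ∣ k := (Dvd.intro c hec.symm).trans (Nat.gcd_dvd_right _ _)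
  obtain ⟨l, rfl⟩ := hdk
  rw [pow_mul]
  refine Subgroup.pow_mem _ ?_ l
  -- Bézout coefficient of m: the multiple of `orderOf a` in gcd(`orderOf a`, m) does not affect the
  -- power of a.
  refine ⟨(orderOf a).gcdB m, ?_⟩
  simp only
  rw [← zpow_natCast a ((orderOf a).gcd m), Nat.gcd_eq_gcd_ab, zpow_add, zpow_mul, zpow_mul,
    zpow_natCast, zpow_natCast, pow_orderOf_eq_one, one_zpow, one_mul]

theorem conj_mem_zpowers [Finite G] {a x g : G} (hx : x ∈ Subgroup.zpowers a)
    (hg : g⁻¹ * x * g ∈ Subgroup.zpowers a) : g⁻¹ * x * g ∈ Subgroup.zpowers x := by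
  refine mem_zpowers_of_orderOf_dvd hx hg (dvd_of_eq ?_)
  have := (MulAut.conj g⁻¹).orderOf_eq x
  simpa using this

/-- Since a centralizes x, conjugation by b acts on ⟨x⟩ as conjugation by ab, whose square is the
identity. So b² centralizes x, and b, having odd order, is a power of b². -/
theorem commute_of_conj_mem_zpowers {a b x : G} (hab : (a * b) * (a * b) = 1)
    (hb : Odd (orderOf b)) (hx : x ∈ Subgroup.zpowers a)
    (h : b⁻¹ * x * b ∈ Subgroup.zpowers x) : Commute b x := by
  obtain ⟨r, hr⟩ := h
  have hax : Commute a x := by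
    obtain ⟨k, rfl⟩ := hx
    exact (Commute.refl a).zpow_right k
  have hb2 : (b⁻¹ * b⁻¹) * x * (b * b) = x := by
    have e1 : ∀ n : ℤ, b⁻¹ * x ^ n * b = (x ^ n) ^ r := fun n => by
      have := map_zpow (MulAut.conj b⁻¹) x n
      simp only [MulAut.conj_apply, inv_inv] at this
      rw [this, ← hr, ← zpow_mul, ← zpow_mul, mul_comm]
    have e2 : ∀ n : ℤ, (a * b)⁻¹ * x ^ n * (a * b) = b⁻¹ * x ^ n * b := fun n => by
      have := (hax.zpow_right n).eq
      calc (a * b)⁻¹ * x ^ n * (a * b) = b⁻¹ * a⁻¹ * (x ^ n * a) * b := by group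
        _ = b⁻¹ * a⁻¹ * (a * x ^ n) * b := by rw [this]
        _ = _ := by group
    have e3 : (a * b)⁻¹ * ((a * b)⁻¹ * x * (a * b)) * (a * b) = x := by
      have : (a * b)⁻¹ = a * b := inv_eq_of_mul_eq_one_left hab
      calc _ = (a * b)⁻¹ * (a * b)⁻¹ * x * (a * b * (a * b)) := by group
        _ = x := by rw [this, hab]; group
    have e4 := e2 1
    rw [zpow_one, ← hr] at e4
    rw [e4] at e3
    have e5 := e2 r
    simp only at e3
    rw [e5] at e3
    calc _ = b⁻¹ * (b⁻¹ * x * b) * b := by group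
      _ = x := by rw [← hr]; exact e3
  have hc : Commute (b * b) x := by
    show b * b * x = x * (b * b)
    conv_lhs => rw [← hb2]
    group
  obtain ⟨k, hk⟩ := hb
  have : b = (b * b) ^ (k + 1) := by
    rw [← pow_two, ← pow_mul, show 2 * (k + 1) = (2 * k + 1) + 1 by ring, ← hk, pow_succ,
      pow_orderOf_eq_one, one_mul]
  rw [this]
  exact hc.pow_left _

/-- Orbit-stabilizer for K acting on G/H. It compares [K : H ∩ K] with [G : H] even when KH is not a
subgroup. -/
theorem relIndex_eq_ncard_image (H K : Subgroup G) :
    H.relIndex K = ((fun g : G => (g : G ⧸ H)) '' K).ncard := by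
  have h := MulAction.index_stabilizer K ((1 : G) : G ⧸ H)
  have e1 : MulAction.stabilizer K ((1 : G) : G ⧸ H) = H.subgroupOf K := by
    ext ⟨k, hk⟩
    rw [MulAction.mem_stabilizer_iff, Subgroup.mem_subgroupOf]
    show ((k * 1 : G) : G ⧸ H) = ((1 : G) : G ⧸ H) ↔ _
    rw [mul_one, eq_comm, QuotientGroup.eq]
    simp
  have e2 : MulAction.orbit K ((1 : G) : G ⧸ H) = (fun g : G => (g : G ⧸ H)) '' K := by
    ext x
    constructor
    · rintro ⟨⟨k, hk⟩, rfl⟩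
      exact ⟨k, hk, by show _ = ((k * 1 : G) : G ⧸ H); rw [mul_one]⟩
    · rintro ⟨k, hk, rfl⟩
      exact ⟨⟨k, hk⟩, by show ((k * 1 : G) : G ⧸ H) = _; rw [mul_one]⟩
  rw [e1, e2] at h
  exact h

theorem index_eq_relIndex_of_mul (H K : Subgroup G) (h : ∀ g, ∃ x ∈ K, ∃ y ∈ H, g = x * y) :
    H.index = H.relIndex K := by
  have : (fun g : G => (g : G ⧸ H)) '' K = Set.univ := by
    refine Set.eq_univ_iff_forall.2 fun g => ?_
    induction g using QuotientGroup.induction_on with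
    | H g =>
      obtain ⟨x, hx, y, hy, rfl⟩ := h g
      exact ⟨x, hx, by rw [QuotientGroup.eq]; simpa using hy⟩
  rw [relIndex_eq_ncard_image, this, Set.ncard_univ]
  rfl

/-- Commuting elements of order dividing `d` generate a subgroup of order dividing `d ^ 2`. -/
theorem card_sup_zpowers_dvd {x y : G} (hxy : Commute x y) :
    Nat.card (Subgroup.zpowers x ⊔ Subgroup.zpowers y : Subgroup G) ∣ orderOf x * orderOf y := by
  have hc : ∀ (m : Subgroup.zpowers x) (n : Subgroup.zpowers y),
      Commute ((Subgroup.zpowers x).subtype m) ((Subgroup.zpowers y).subtype n) := by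
    rintro ⟨_, m, rfl⟩ ⟨_, n, rfl⟩
    exact (hxy.zpow_left m).zpow_right n
  have h := Subgroup.card_dvd_of_surjective _ (MonoidHom.noncommCoprod _ _ hc).rangeRestrict_surjective
  rw [MonoidHom.noncommCoprod_range, Subgroup.range_subtype, Subgroup.range_subtype,
    Nat.card_prod, Nat.card_zpowers, Nat.card_zpowers] at h
  exact h

variable [Finite G]

theorem relIndex_le_index_of_finite (H K : Subgroup G) : H.relIndex K ≤ H.index := by
  rw [relIndex_eq_ncard_image]
  exact (Set.ncard_le_card _)

theorem relIndex_lt_index (H K : Subgroup G) {g : G} (hg : ∀ x ∈ K, ∀ y ∈ H, g ≠ x * y) :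
    H.relIndex K < H.index := by
  rw [relIndex_eq_ncard_image]
  have := Set.ncard_lt_ncard (s := (fun g : G => (g : G ⧸ H)) '' K) (t := Set.univ)
    (Set.ssubset_univ_iff.2 fun h => by
      obtain ⟨x, hx, hxg⟩ := h.ge (Set.mem_univ (g : G ⧸ H))
      exact hg x hx _ (QuotientGroup.eq.1 hxg) (by group))
  rwa [Set.ncard_univ] at this

/-! ### Products of two cyclic groups -/

/-- In a product of a cyclic group `⟨a⟩` with a nontrivial cyclic group `⟨b⟩` of odd order, where
`a * b` is an involution, some nontrivial power of `b` commutes with the conjugate of `b`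
by that involution. -/
theorem exists_commute_conj {a b : G} (hab : (a * b) * (a * b) = 1) (hb : Odd (orderOf b))
    (h : ∀ g, ∃ x ∈ Subgroup.zpowers a, ∃ y ∈ Subgroup.zpowers b, g = x * y) (hb1 : b ≠ 1) :
    ∃ z ∈ Subgroup.zpowers b, z ≠ 1 ∧ Commute b ((a * b) * z * (a * b)) := by
  by_cases hba : b ∈ Subgroup.zpowers a
  · refine ⟨b, Subgroup.mem_zpowers b, hb1, ?_⟩
    have hc : Commute a b := by
      obtain ⟨k, rfl⟩ := hba
      exact (Commute.refl a).zpow_right k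
    have : Commute b (a * b) := hc.symm.mul_right (Commute.refl b)
    exact (this.mul_right (Commute.refl b)).mul_right this
  by_contra! hz
  have ht : (a * b)⁻¹ = a * b := inv_eq_of_mul_eq_one_left hab
  set A := Subgroup.zpowers a with hA
  set B := Subgroup.zpowers b with hB
  set K := A.map (MulAut.conj b).toMonoidHom with hK
  set C := Subgroup.centralizer {b} with hC
  have hmem : ∀ x, x ∈ C ↔ Commute b x := fun x => by
    rw [hC, Subgroup.mem_centralizer_singleton_iff]
    exact ⟨fun h => h.symm, fun h => h.symm⟩
  have hBC : B ≤ C := by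
    rw [hB, Subgroup.zpowers_le, hmem]
  have hKA : A ⊓ K ≤ C := by
    rintro x ⟨hx, y, hy, rfl⟩
    simp only [MulEquiv.toMonoidHom_eq_coe, MonoidHom.coe_coe, MulAut.conj_apply] at hx ⊢
    rw [hmem]
    refine commute_of_conj_mem_zpowers hab hb hx (conj_mem_zpowers hx ?_)
    have : b⁻¹ * (b * y * b⁻¹) * b = y := by group
    rw [this]
    exact hy
  -- If no z works, the centralizer C of b meets the conjugate of B by ab trivially. The chain |b| ≤
  -- [G:C] = [A:A∩C] ≤ [A:A∩K] < [G:K] = [G:A] ≤ |b| is then absurd.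
  have h1 : orderOf b ≤ C.index := by
    refine le_trans (le_of_eq ?_) (relIndex_le_index_of_finite C (B.map (MulAut.conj (a * b)).toMonoidHom))
    rw [← Subgroup.inf_relIndex_right]
    have : C ⊓ B.map (MulAut.conj (a * b)).toMonoidHom = ⊥ := by
      rw [eq_bot_iff]
      rintro _ ⟨hx, y, hy, rfl⟩
      simp only [MulEquiv.toMonoidHom_eq_coe, MonoidHom.coe_coe, MulAut.conj_apply] at hx ⊢
      by_cases hy1 : y = 1
      · simp [hy1]
      · have h' := (hmem _).1 hx
        rw [ht] at h'
        exact (hz y hy hy1 h').elim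
    rw [this, Subgroup.relIndex_bot_left, Subgroup.card_map_of_injective
      (MulAut.conj (a * b)).injective, Nat.card_zpowers]
  have h2 : C.index = C.relIndex A := index_eq_relIndex_of_mul C A fun g => by
    obtain ⟨x, hx, y, hy, e⟩ := h g
    exact ⟨x, hx, y, hBC hy, e⟩
  have h3 : C.relIndex A ≤ K.relIndex A := by
    rw [← Subgroup.inf_relIndex_left A K]
    exact Subgroup.relIndex_le_of_le_left hKA
      (fun h0 => Subgroup.index_ne_zero_of_finite (Subgroup.index_eq_zero_of_relIndex_eq_zero h0))
  -- Strictness: b⁻¹ in AK, with K = bAb⁻¹, would put b in A.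
  have h4 : K.relIndex A < K.index := by
    refine relIndex_lt_index K A (g := b⁻¹) ?_
    rintro x hx _ ⟨y, hy, rfl⟩ e
    simp only [MulEquiv.toMonoidHom_eq_coe, MonoidHom.coe_coe, MulAut.conj_apply] at e
    apply hba
    have : b = x⁻¹ * y⁻¹ := by
      have e' : x * b * y = 1 := by
        calc x * b * y = (x * (b * y * b⁻¹)) * b := by group
          _ = 1 := by rw [← e]; group
      calc b = x⁻¹ * (x * b * y) * y⁻¹ := by group
        _ = _ := by rw [e']; group
    rw [this]
    exact A.mul_mem (A.inv_mem hx) (A.inv_mem hy)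
  have h5 : K.index = A.index :=
    Subgroup.index_map_of_bijective (MulAut.conj b).bijective A
  have h6 : A.index ≤ orderOf b := by
    rw [index_eq_relIndex_of_mul A B, ← Nat.card_zpowers]
    · exact Nat.le_of_dvd Nat.card_pos (Subgroup.relIndex_dvd_card _ _)
    · intro g
      obtain ⟨x, hx, y, hy, e⟩ := h g⁻¹
      exact ⟨y⁻¹, B.inv_mem hy, x⁻¹, A.inv_mem hx, by rw [← mul_inv_rev, ← e, inv_inv]⟩
  omega

/-- By finiteness, a conjugate contained in H equals H, so each generator normalizes H. -/
theorem normal_of_closure_eq_top {S : Set G} (hS : Subgroup.closure S = ⊤) {H : Subgroup G}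
    (h : ∀ g ∈ S, H.map (MulAut.conj g⁻¹).toMonoidHom ≤ H) : H.Normal := by
  rw [← Subgroup.normalizer_eq_top_iff, eq_top_iff, ← hS, Subgroup.closure_le]
  intro g hg
  have h1 : H.map (MulAut.conj g⁻¹).toMonoidHom = H :=
    Subgroup.eq_of_le_of_card_ge (h g hg)
      (Subgroup.card_map_of_injective (MulAut.conj g⁻¹).injective).ge
  rw [SetLike.mem_coe, ← inv_mem_iff, Subgroup.mem_normalizer_iff_map_conj_eq]
  exact h1

/-- A cyclic subgroup `⟨b⟩` of odd order with trivial core is at most as large as its index,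
if it generates the group together with one further element. -/
theorem orderOf_le_index_of_normalCore_eq_bot {a b : G} (h : Subgroup.closure {a, b} = ⊤)
    (hcore : (Subgroup.zpowers b).normalCore = ⊥) :
    orderOf b ≤ (Subgroup.zpowers b).index := by
  set B := Subgroup.zpowers b with hB
  set K := B.map (MulAut.conj a).toMonoidHom with hK
  -- For x in the intersection, a⁻¹xa lies in B and has the order of x, hence lies in ⟨x⟩. As b
  -- centralizes x, the subgroup ⟨x⟩ is normal and falls into the core.
  have hKB : B ⊓ K = ⊥ := by
    rw [eq_bot_iff]
    rintro x ⟨hx, y, hy, rfl⟩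
    simp only [MulEquiv.toMonoidHom_eq_coe, MonoidHom.coe_coe, MulAut.conj_apply] at hx ⊢
    have hy' : a⁻¹ * (a * y * a⁻¹) * a = y := by group
    have hxy : a⁻¹ * (a * y * a⁻¹) * a ∈ Subgroup.zpowers (a * y * a⁻¹) :=
      conj_mem_zpowers hx (by rw [hy']; exact hy)
    set x := a * y * a⁻¹ with hxdef
    have hnorm : (Subgroup.zpowers x).Normal := by
      refine normal_of_closure_eq_top h ?_
      rintro g (rfl | rfl) <;> rw [MonoidHom.map_zpowers, Subgroup.zpowers_le]
      · simpa using hxy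
      · have : Commute g x := by
          obtain ⟨k, hk⟩ := hx
          rw [← hk]
          exact (Commute.refl g).zpow_right k
        have e : (MulAut.conj g⁻¹).toMonoidHom x = x := by
          simp [mul_assoc, this.symm.eq]
        rw [e]
        exact Subgroup.mem_zpowers x
    have := (Subgroup.normal_le_normalCore (H := B)).2 (Subgroup.zpowers_le.2 hx)
    rw [hcore] at this
    exact this (Subgroup.mem_zpowers x)
  calc orderOf b = Nat.card K := by
        rw [hK, Subgroup.card_map_of_injective (MulAut.conj a).injective, Nat.card_zpowers]
    _ = B.relIndex K := by rw [← Subgroup.inf_relIndex_right, hKB, Subgroup.relIndex_bot_left]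
    _ ≤ B.index := relIndex_le_index_of_finite _ _

theorem card_dvd_two_mul_orderOf_sq {G : Type*} [Group G] [Finite G] {a b : G}
    (hab : (a * b) * (a * b) = 1) (hb : Odd (orderOf b))
    (h : ∀ g, ∃ x ∈ Subgroup.zpowers a, ∃ y ∈ Subgroup.zpowers b, g = x * y) :
    Nat.card G ∣ 2 * orderOf b ^ 2 := by
  induction hn : Nat.card G using Nat.strong_induction_on generalizing G with
  | _ n ih =>
  subst hn
  -- Base case: G = ⟨a⟩ and a² = 1.
  by_cases hb1 : b = 1
  · subst hb1
    have htop : Subgroup.zpowers a = ⊤ := by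
      refine eq_top_iff.2 fun g _ => ?_
      obtain ⟨x, hx, y, hy, rfl⟩ := h g
      rw [Subgroup.zpowers_one_eq_bot, Subgroup.mem_bot] at hy
      rwa [hy, mul_one]
    rw [← Subgroup.card_top, ← htop, Nat.card_zpowers, orderOf_one]
    refine orderOf_dvd_of_pow_eq_one ?_
    simpa [pow_two] using hab
  obtain ⟨z, hzb, hz1, hz⟩ := exists_commute_conj hab hb h hb1
  have ht : (a * b)⁻¹ = a * b := inv_eq_of_mul_eq_one_left hab
  set z' := (a * b) * z * (a * b) with hz'
  have hbz : Commute b z := by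
    obtain ⟨k, rfl⟩ := hzb
    exact (Commute.refl b).zpow_right k
  have hzz' : Commute z z' := by
    obtain ⟨k, rfl⟩ := hzb
    exact hz.zpow_left k
  have htz : (a * b) * z' * (a * b) = z := by
    calc _ = (a * b) * (a * b) * z * ((a * b) * (a * b)) := by rw [hz']; group
      _ = z := by rw [hab]; group
  have hord : orderOf z' = orderOf z := by
    have := (MulAut.conj (a * b)).orderOf_eq z
    rwa [MulAut.conj_apply, ht] at this
  set F : Subgroup G := Subgroup.zpowers z ⊔ Subgroup.zpowers z' with hF
  have hzF : z ∈ F := Subgroup.mem_sup_left (Subgroup.mem_zpowers z)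
  have hz'F : z' ∈ F := Subgroup.mem_sup_right (Subgroup.mem_zpowers z')
  have hgen : Subgroup.closure {a * b, b} = ⊤ := by
    refine eq_top_iff.2 fun g _ => ?_
    have h1 : a * b ∈ Subgroup.closure {a * b, b} := Subgroup.subset_closure (by simp)
    have h2 : b ∈ Subgroup.closure {a * b, b} := Subgroup.subset_closure (by simp)
    have h3 : a ∈ Subgroup.closure {a * b, b} := by
      simpa using Subgroup.mul_mem _ h1 (Subgroup.inv_mem _ h2)
    obtain ⟨x, hx, y, hy, rfl⟩ := h g
    exact Subgroup.mul_mem _ (Subgroup.zpowers_le.2 h3 hx) (Subgroup.zpowers_le.2 h2 hy)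
  -- Conjugation by ab swaps z and z', while b centralizes both.
  have hnormal : F.Normal := by
    refine normal_of_closure_eq_top hgen ?_
    rintro g (rfl | rfl) <;>
      rw [hF, Subgroup.map_sup, MonoidHom.map_zpowers, MonoidHom.map_zpowers, ← hF, sup_le_iff,
        Subgroup.zpowers_le, Subgroup.zpowers_le]
    · simp only [MulEquiv.toMonoidHom_eq_coe, MonoidHom.coe_coe, MulAut.conj_apply, ht, htz]
      exact ⟨hz'F, hzF⟩
    · have e1 : (MulAut.conj g⁻¹).toMonoidHom z = z := by simp [mul_assoc, hbz.symm.eq]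
      have e2 : (MulAut.conj g⁻¹).toMonoidHom z' = z' := by
        rw [MulEquiv.toMonoidHom_eq_coe, MonoidHom.coe_coe, MulAut.conj_apply, inv_inv, mul_assoc,
          hz.symm.eq, inv_mul_cancel_left]
      rw [e1, e2]
      exact ⟨hzF, hz'F⟩
  obtain ⟨e, he⟩ : orderOf z ∣ orderOf b := orderOf_dvd_of_mem_zpowers hzb
  have hbe : b ^ e ∈ F := by
    refine Subgroup.zpowers_le.2 hzF
      (mem_zpowers_of_orderOf_dvd hzb (Subgroup.npow_mem_zpowers b e) ?_)
    refine orderOf_dvd_of_pow_eq_one ?_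
    rw [← pow_mul, mul_comm, ← he, pow_orderOf_eq_one]
  have hb'e : orderOf (QuotientGroup.mk' F b) ∣ e := by
    refine orderOf_dvd_of_pow_eq_one ?_
    rw [← map_pow]
    exact (QuotientGroup.eq_one_iff _).2 hbe
  have hcard : Nat.card G = Nat.card (G ⧸ F) * Nat.card F :=
    Subgroup.card_eq_card_quotient_mul_card_subgroup F
  have hF1 : 1 < Nat.card F := by
    rw [Subgroup.one_lt_card_iff_ne_bot]
    intro hbot
    rw [hbot] at hzF
    exact hz1 hzF
  have hlt : Nat.card (G ⧸ F) < Nat.card G := by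
    rw [hcard]
    exact lt_mul_of_one_lt_right Nat.card_pos hF1
  have key := ih _ hlt (a := QuotientGroup.mk' F a) (b := QuotientGroup.mk' F b)
    (by rw [← map_mul, ← map_mul, hab, map_one])
    (hb.of_dvd_nat (hb'e.trans (Dvd.intro_left _ he.symm)))
    (fun g => by
      obtain ⟨g, rfl⟩ := QuotientGroup.mk'_surjective F g
      obtain ⟨x, hx, y, hy, rfl⟩ := h g
      obtain ⟨i, rfl⟩ := hx
      obtain ⟨j, rfl⟩ := hy
      exact ⟨_, ⟨i, rfl⟩, _, ⟨j, rfl⟩, by simp⟩) rfl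
  have hFd : Nat.card F ∣ orderOf z ^ 2 := by
    have := card_sup_zpowers_dvd hzz'
    rwa [hord, ← pow_two] at this
  -- With |b| = |z|e, |F| divides |z|² and |G/F| divides 2e².
  rw [hcard, he, mul_pow, mul_left_comm, mul_comm]
  exact mul_dvd_mul hFd (key.trans (mul_dvd_mul_left 2 (pow_dvd_pow_of_dvd hb'e 2)))

/-- Disjointness supplies the reverse inequality |a||b| ≤ |G|, so G is the exact product ⟨a⟩⟨b⟩ and
the divisibility bound applies. -/
theorem orderOf_of_card_le_mul {a b : G} (hab : (a * b) * (a * b) = 1)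
    (hb : Odd (orderOf b)) (ha : a ≠ 1)
    (hdisj : Disjoint (Subgroup.zpowers a) (Subgroup.zpowers b))
    (hcard : Nat.card G ≤ orderOf a * orderOf b) :
    (Even (orderOf a) ∧ orderOf a ∣ 2 * orderOf b) ∧
      ((Subgroup.zpowers b).normalCore = ⊥ → orderOf a = 2 * orderOf b) := by
  have hinj := Subgroup.mul_injective_of_disjoint hdisj
  have hcard' : Nat.card G = orderOf a * orderOf b := by
    refine le_antisymm hcard ?_
    have := Nat.card_le_card_of_injective _ hinj
    rwa [Nat.card_prod, Nat.card_zpowers, Nat.card_zpowers] at this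
  have hcompl : Subgroup.IsComplement' (Subgroup.zpowers a) (Subgroup.zpowers b) := by
    refine Subgroup.isComplement'_of_card_mul_and_disjoint ?_ hdisj
    rw [Nat.card_zpowers, Nat.card_zpowers, hcard']
  have h : ∀ g, ∃ x ∈ Subgroup.zpowers a, ∃ y ∈ Subgroup.zpowers b, g = x * y := fun g => by
    obtain ⟨⟨⟨x, hx⟩, ⟨y, hy⟩⟩, e⟩ := hcompl.surjective g
    exact ⟨x, hx, y, hy, e.symm⟩
  have hq : 0 < orderOf b := orderOf_pos b
  have heven : Even (orderOf a) := by
    by_contra hodd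
    rw [Nat.not_even_iff_odd] at hodd
    have hGodd : Odd (Nat.card G) := hcard' ▸ hodd.mul hb
    have h2 : orderOf (a * b) ∣ 2 := orderOf_dvd_of_pow_eq_one (by rw [pow_two, hab])
    have h3 : orderOf (a * b) = 1 :=
      Nat.Coprime.eq_one_of_dvd ((Nat.coprime_two_right.2
        (hGodd.of_dvd_nat (orderOf_dvd_natCard (a * b))))) h2
    rw [orderOf_eq_one_iff, mul_eq_one_iff_eq_inv] at h3
    exact ha (Subgroup.disjoint_def.1 hdisj (Subgroup.mem_zpowers a)
      (h3 ▸ Subgroup.inv_mem _ (Subgroup.mem_zpowers b)))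
  have hdvd : orderOf a ∣ 2 * orderOf b := by
    have := card_dvd_two_mul_orderOf_sq hab hb h
    rw [hcard', pow_two, ← mul_assoc] at this
    exact Nat.dvd_of_mul_dvd_mul_right hq this
  refine ⟨⟨heven, hdvd⟩, fun hcore => ?_⟩
  have hgen : Subgroup.closure {a, b} = ⊤ := by
    refine eq_top_iff.2 fun g _ => ?_
    obtain ⟨x, hx, y, hy, rfl⟩ := h g
    exact Subgroup.mul_mem _ (Subgroup.zpowers_le.2 (Subgroup.subset_closure (by simp)) hx)
      (Subgroup.zpowers_le.2 (Subgroup.subset_closure (by simp)) hy)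
  have hle := orderOf_le_index_of_normalCore_eq_bot hgen hcore
  have hidx := Subgroup.index_mul_card (Subgroup.zpowers b)
  rw [Nat.card_zpowers, hcard'] at hidx
  rw [Nat.eq_of_mul_eq_mul_right hq hidx] at hle
  have hlt : orderOf b < orderOf a := lt_of_le_of_ne hle fun e => by
    rw [← e] at heven
    exact (Nat.not_even_iff_odd.2 hb) heven
  obtain ⟨c, hc⟩ := hdvd
  have hc1 : c = 1 := by
    have h1 : c < 2 := by
      by_contra! h2
      have := Nat.mul_le_mul_left (orderOf a) h2
      omega
    have h2 : c ≠ 0 := by rintro rfl; omega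
    omega
  rw [hc, hc1, mul_one]

end CyclicFactorization

theorem Set.nonempty_of_encard_eq_two {α : Type*} {S : Set α} (h : S.encard = 2) : S.Nonempty := by
  rw [← Set.encard_pos, h]; decide

namespace AbstractPolyhedron

variable {P : Type*} [PartialOrder P] {K : AbstractPolyhedron P}

/-! ### Incidence and flags -/

theorem _root_.Incident.symm {x y : P} (h : Incident x y) : Incident y x := Or.symm h

theorem _root_.Incident.map {x y : P} (h : Incident x y) (φ : P ≃o P) : Incident (φ x) (φ y) :=
  h.imp (fun h => φ.monotone h) (fun h => φ.monotone h)

theorem le_of_incident {x y : P} (h : Incident x y) (hr : K.rank x < K.rank y) : x ≤ y :=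
  h.resolve_right fun h' => absurd (K.rank_strictMono.monotone h') (not_le.2 hr)

theorem eq_of_incident_of_rank_eq {x y : P} (h : Incident x y) (hr : K.rank x = K.rank y) :
    x = y := by
  by_contra hne
  rcases h with h | h
  · exact (K.rank_strictMono (lt_of_le_of_ne h hne)).ne hr
  · exact (K.rank_strictMono (lt_of_le_of_ne h (Ne.symm hne))).ne' hr

theorem incident_trans {v e f : P} (hv : K.rank v = 0) (he : K.rank e = 1) (hf : K.rank f = 2)
    (h1 : Incident v e) (h2 : Incident e f) : Incident v f :=
  Or.inl ((le_of_incident (K := K) h1 (by rw [hv, he]; decide)).trans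
    (le_of_incident (K := K) h2 (by rw [he, hf]; decide)))

namespace Flag

/-- A uniform form of the three "exactly two" axioms. For vertices and faces, incidence with the
edge already implies the other incidence. -/
theorem encard_candidates (Φ : K.Flag) (i : Fin 3) :
    {x | K.rank x = i ∧ ∀ j, j ≠ i → Incident x (Φ.elt j)}.encard = 2 := by
  have h0 := Φ.rank_elt 0
  have h1 := Φ.rank_elt 1
  have h2 := Φ.rank_elt 2
  obtain rfl | rfl | rfl : i = 0 ∨ i = 1 ∨ i = 2 := by revert i; decide
  · rw [← K.edge_vertices _ h1]
    congr 1
    ext x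
    refine ⟨fun h => ⟨h.1, h.2 1 (by decide)⟩, fun h => ⟨h.1, fun j hj => ?_⟩⟩
    obtain rfl | rfl : j = 1 ∨ j = 2 := by revert j; decide
    · exact h.2
    · exact incident_trans h.1 h1 h2 h.2 (Φ.incident 1 2)
  · rw [← K.diamond _ _ h0 h2 (Φ.incident 0 2)]
    congr 1
    ext x
    refine ⟨fun h => ⟨h.1, h.2 0 (by decide), h.2 2 (by decide)⟩, fun h => ⟨h.1, fun j hj => ?_⟩⟩
    obtain rfl | rfl : j = 0 ∨ j = 2 := by revert j; decide
    · exact h.2.1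
    · exact h.2.2
  · rw [← K.edge_faces _ h1]
    congr 1
    ext x
    refine ⟨fun h => ⟨h.1, h.2 1 (by decide)⟩, fun h => ⟨h.1, fun j hj => ?_⟩⟩
    obtain rfl | rfl : j = 0 ∨ j = 1 := by revert j; decide
    · exact (incident_trans h0 h1 h.1 (Φ.incident 0 1) h.2.symm).symm
    · exact h.2

/-- Replace the element of rank `i` of a flag. -/
def replace (Φ : K.Flag) (i : Fin 3) (x : P) (hx : K.rank x = i)
    (h : ∀ j, j ≠ i → Incident x (Φ.elt j)) : K.Flag where
  elt := Function.update Φ.elt i x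
  rank_elt j := by
    by_cases hj : j = i
    · subst hj; simpa using hx
    · simpa [hj] using Φ.rank_elt j
  incident j k := by
    by_cases hj : j = i <;> by_cases hk : k = i
    · subst hj; subst hk; exact Or.inl le_rfl
    · subst hj; simpa [hk] using h k hk
    · subst hk; simpa [hj] using (h j hj).symm
    · simpa [hj, hk] using Φ.incident j k

theorem eq_of_agree {Φ Ψ : K.Flag} {i : Fin 3} (h : ∀ j, j ≠ i → Ψ.elt j = Φ.elt j)
    (hi : Ψ.elt i = Φ.elt i) : Ψ = Φ := by
  ext j
  by_cases hj : j = i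
  · rw [hj, hi]
  · exact h j hj

theorem exists_adjacentAt (Φ : K.Flag) (i : Fin 3) :
    ∃ Ψ, AdjacentAt i Φ Ψ ∧ ∀ Ω : K.Flag, (∀ j, j ≠ i → Ω.elt j = Φ.elt j) → Ω = Φ ∨ Ω = Ψ := by
  obtain ⟨x, y, hxy, hs⟩ := Set.encard_eq_two.1 (Φ.encard_candidates i)
  have mem : ∀ Ω : K.Flag, (∀ j, j ≠ i → Ω.elt j = Φ.elt j) → Ω.elt i = x ∨ Ω.elt i = y :=
    fun Ω hΩ => by
      have : Ω.elt i ∈ {x | K.rank x = i ∧ ∀ j, j ≠ i → Incident x (Φ.elt j)} :=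
        ⟨Ω.rank_elt i, fun j hj => hΩ j hj ▸ Ω.incident i j⟩
      rw [hs] at this
      simpa using this
  have key : ∀ z, z ∈ ({x, y} : Set P) → z ≠ Φ.elt i →
      (∀ w, w = x ∨ w = y → w = Φ.elt i ∨ w = z) → ∃ Ψ, AdjacentAt i Φ Ψ ∧
        ∀ Ω : K.Flag, (∀ j, j ≠ i → Ω.elt j = Φ.elt j) → Ω = Φ ∨ Ω = Ψ := by
    intro z hz hne hw
    rw [← hs] at hz
    have hΨ : ∀ j, j ≠ i → (Φ.replace i z hz.1 hz.2).elt j = Φ.elt j := fun j hj => by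
      simp [replace, hj]
    have hΨi : (Φ.replace i z hz.1 hz.2).elt i = z := by simp [replace]
    refine ⟨Φ.replace i z hz.1 hz.2, fun j => ?_, fun Ω hΩ => ?_⟩
    · by_cases hj : j = i
      · subst hj
        simpa [hΨi] using hne.symm
      · simp [hj, hΨ]
    · rcases hw _ (mem Ω hΩ) with h | h
      · exact Or.inl (eq_of_agree hΩ h)
      · exact Or.inr (eq_of_agree (fun j hj => (hΩ j hj).trans (hΨ j hj).symm) (h.trans hΨi.symm))
  rcases mem Φ (fun _ _ => rfl) with h | h
  · exact key y (by simp) (by rw [h]; exact hxy.symm) (by rw [h]; exact fun _ h => h)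
  · exact key x (by simp) (by rw [h]; exact hxy) (by rw [h]; exact fun _ h => h.symm)

/-- The flag adjacent to `Φ` that differs from it in the element of rank `i`. -/
noncomputable def adj (i : Fin 3) (Φ : K.Flag) : K.Flag := (Φ.exists_adjacentAt i).choose

theorem adjacentAt_adj (i : Fin 3) (Φ : K.Flag) : AdjacentAt i Φ (Φ.adj i) :=
  (Φ.exists_adjacentAt i).choose_spec.1

theorem eq_or_eq_adj {i : Fin 3} {Φ Ψ : K.Flag} (h : ∀ j, j ≠ i → Ψ.elt j = Φ.elt j) :
    Ψ = Φ ∨ Ψ = Φ.adj i :=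
  (Φ.exists_adjacentAt i).choose_spec.2 Ψ h

theorem AdjacentAt.elt_eq {i j : Fin 3} {Φ Ψ : K.Flag} (h : AdjacentAt i Φ Ψ) (hj : j ≠ i) :
    Ψ.elt j = Φ.elt j := by
  by_contra hne
  exact hj ((h j).1 (Ne.symm hne))

theorem AdjacentAt.eq_adj {i : Fin 3} {Φ Ψ : K.Flag} (h : AdjacentAt i Φ Ψ) : Ψ = Φ.adj i :=
  (eq_or_eq_adj fun _ hj => h.elt_eq hj).resolve_left
    (by rintro rfl; exact (h i).2 rfl rfl)

theorem AdjacentAt.symm {i : Fin 3} {Φ Ψ : K.Flag} (h : AdjacentAt i Φ Ψ) : AdjacentAt i Ψ Φ :=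
  fun j => by rw [ne_comm]; exact h j

theorem adj_elt {i j : Fin 3} (Φ : K.Flag) (hj : j ≠ i) : (Φ.adj i).elt j = Φ.elt j :=
  (adjacentAt_adj i Φ).elt_eq hj

theorem adj_elt_ne (i : Fin 3) (Φ : K.Flag) : (Φ.adj i).elt i ≠ Φ.elt i :=
  ((adjacentAt_adj i Φ i).2 rfl).symm

theorem adj_adj (i : Fin 3) (Φ : K.Flag) : (Φ.adj i).adj i = Φ :=
  ((adjacentAt_adj i Φ).symm.eq_adj).symm

end Flag

theorem exists_flag_of_triple {x y z : P} (hxy : x ≠ y) (hxz : x ≠ z) (hyz : y ≠ z)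
    (ixy : Incident x y) (ixz : Incident x z) (iyz : Incident y z) :
    ∃ Φ : K.Flag, Φ.elt (K.rank x) = x ∧ Φ.elt (K.rank y) = y ∧ Φ.elt (K.rank z) = z := by
  have rxy : K.rank x ≠ K.rank y := fun h => hxy (eq_of_incident_of_rank_eq ixy h)
  have rxz : K.rank x ≠ K.rank z := fun h => hxz (eq_of_incident_of_rank_eq ixz h)
  have ryz : K.rank y ≠ K.rank z := fun h => hyz (eq_of_incident_of_rank_eq iyz h)
  have cover : ∀ i, i = K.rank x ∨ i = K.rank y ∨ i = K.rank z := by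
    generalize K.rank x = a at *
    generalize K.rank y = b at *
    generalize K.rank z = c at *
    revert a b c
    decide
  classical
  let f : Fin 3 → P := fun i => if i = K.rank x then x else if i = K.rank y then y else z
  have fx : f (K.rank x) = x := by simp [f]
  have fy : f (K.rank y) = y := by simp [f, rxy.symm]
  have fz : f (K.rank z) = z := by simp [f, rxz.symm, ryz.symm]
  refine ⟨⟨f, fun i => ?_, fun i j => ?_⟩, fx, fy, fz⟩
  · rcases cover i with rfl | rfl | rfl
    · rw [fx]
    · rw [fy]
    · rw [fz]
  · rcases cover i with rfl | rfl | rfl <;> rcases cover j with rfl | rfl | rfl <;>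
      simp only [fx, fy, fz]
    exacts [Or.inl le_rfl, ixy, ixz, ixy.symm, Or.inl le_rfl, iyz, ixz.symm, iyz.symm, Or.inl le_rfl]

theorem ne_of_rank_ne {x y : P} (h : K.rank x ≠ K.rank y) : x ≠ y := fun e => h (e ▸ rfl)

theorem exists_flag_of_incident_of_rank_lt {x y : P} (h : Incident x y)
    (hr : K.rank x < K.rank y) : ∃ Φ : K.Flag, Φ.elt (K.rank x) = x ∧ Φ.elt (K.rank y) = y := by
  have hcase : (K.rank x = 0 ∧ K.rank y = 1) ∨ (K.rank x = 0 ∧ K.rank y = 2) ∨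
      (K.rank x = 1 ∧ K.rank y = 2) := by
    revert hr
    generalize K.rank x = a
    generalize K.rank y = b
    revert a b
    decide
  suffices ∃ z, K.rank x ≠ K.rank z ∧ K.rank y ≠ K.rank z ∧ Incident x z ∧ Incident y z by
    obtain ⟨z, h1, h2, h3, h4⟩ := this
    obtain ⟨Φ, hx, hy, -⟩ := exists_flag_of_triple (K := K) (ne_of_rank_ne hr.ne)
      (ne_of_rank_ne h1) (ne_of_rank_ne h2) h h3 h4
    exact ⟨Φ, hx, hy⟩
  rcases hcase with ⟨hx, hy⟩ | ⟨hx, hy⟩ | ⟨hx, hy⟩ <;> rw [hx, hy]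
  · obtain ⟨z, hz, hzi⟩ := Set.nonempty_of_encard_eq_two (K.edge_faces y hy)
    exact ⟨z, by rw [hz]; decide, by rw [hz]; decide,
      incident_trans hx hy hz h hzi.symm, hzi.symm⟩
  · obtain ⟨z, hz, hzx, hzy⟩ := Set.nonempty_of_encard_eq_two (K.diamond x y hx hy h)
    exact ⟨z, by rw [hz]; decide, by rw [hz]; decide, hzx.symm, hzy.symm⟩
  · obtain ⟨z, hz, hzi⟩ := Set.nonempty_of_encard_eq_two (K.edge_vertices x hx)
    exact ⟨z, by rw [hz]; decide, by rw [hz]; decide, hzi.symm,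
      (incident_trans hz hx hy hzi h).symm⟩

theorem exists_flag_of_incident {x y : P} (hne : x ≠ y) (h : Incident x y) :
    ∃ Φ : K.Flag, Φ.elt (K.rank x) = x ∧ Φ.elt (K.rank y) = y := by
  rcases lt_trichotomy (K.rank x) (K.rank y) with hr | hr | hr
  · exact exists_flag_of_incident_of_rank_lt h hr
  · exact absurd (eq_of_incident_of_rank_eq h hr) hne
  · obtain ⟨Φ, h1, h2⟩ := exists_flag_of_incident_of_rank_lt h.symm hr
    exact ⟨Φ, h2, h1⟩

theorem exists_flag (x : P) : ∃ Φ : K.Flag, Φ.elt (K.rank x) = x := by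
  suffices ∃ y, x ≠ y ∧ Incident x y by
    obtain ⟨y, h1, h2⟩ := this
    obtain ⟨Φ, h, -⟩ := exists_flag_of_incident (K := K) h1 h2
    exact ⟨Φ, h⟩
  by_cases hx : K.rank x = 1
  · obtain ⟨z, hz, hzi⟩ := Set.nonempty_of_encard_eq_two (K.edge_vertices x hx)
    exact ⟨z, ne_of_rank_ne (K := K) (by rw [hx, hz]; decide), hzi.symm⟩
  · have hx' : K.rank x = 0 ∨ K.rank x = 2 := by
      revert hx
      generalize K.rank x = a
      revert a
      decide
    obtain ⟨⟨y, hy⟩⟩ := (K.link_connected x hx').nonempty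
    exact ⟨y, hy⟩

/-! ### Automorphisms acting on flags -/

/-- The image of a flag is a chain of three elements, and 0 < 1 < 2 is the only such chain of ranks.
-/
theorem rank_map (φ : P ≃o P) (x : P) : K.rank (φ x) = K.rank x := by
  obtain ⟨Φ, hΦ⟩ := exists_flag (K := K) x
  have lt : ∀ i j, i < j → Φ.elt i < Φ.elt j := fun i j hij => by
    refine lt_of_le_of_ne (le_of_incident (K := K) (Φ.incident i j) ?_)
      (ne_of_rank_ne (K := K) ?_) <;> rw [Φ.rank_elt, Φ.rank_elt]
    exacts [hij, hij.ne]
  have h01 := K.rank_strictMono (φ.strictMono (lt 0 1 (by decide)))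
  have h12 := K.rank_strictMono (φ.strictMono (lt 1 2 (by decide)))
  have : ∀ i, K.rank (φ (Φ.elt i)) = i := by
    have key : ∀ a b c : Fin 3, a < b → b < c → a = 0 ∧ b = 1 ∧ c = 2 := by decide
    obtain ⟨h0, h1, h2⟩ := key _ _ _ h01 h12
    intro i
    obtain rfl | rfl | rfl : i = 0 ∨ i = 1 ∨ i = 2 := by revert i; decide
    exacts [h0, h1, h2]
  rw [← hΦ, this, Φ.rank_elt]

instance : MulAction (P ≃o P) K.Flag where
  smul φ Φ :=
    { elt := fun i => φ (Φ.elt i)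
      rank_elt := fun i => by rw [rank_map, Φ.rank_elt]
      incident := fun i j => (Φ.incident i j).map φ }
  one_smul _ := rfl
  mul_smul _ _ _ := rfl

namespace Flag

@[simp]
theorem smul_elt (φ : P ≃o P) (Φ : K.Flag) (i : Fin 3) : (φ • Φ).elt i = φ (Φ.elt i) := rfl

theorem sends_iff {φ : P ≃o P} {Φ Ψ : K.Flag} : Sends φ Φ Ψ ↔ φ • Φ = Ψ :=
  ⟨fun h => Flag.ext (funext h), fun h i => by rw [← h, smul_elt]⟩

theorem smul_adj (φ : P ≃o P) (Φ : K.Flag) (i : Fin 3) : φ • Φ.adj i = (φ • Φ).adj i := by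
  refine AdjacentAt.eq_adj fun j => ?_
  rw [← adjacentAt_adj i Φ j, smul_elt, smul_elt, ne_eq, φ.injective.eq_iff]

/-- A set of flags through `x` that is closed under those adjacencies that keep `x`
contains all flags through `x` as soon as it contains one. -/
theorem mem_of_adj_closed {S : Set K.Flag} {x : P} {Φ Ψ : K.Flag} (hΦ : Φ.elt (K.rank x) = x)
    (hΨ : Ψ.elt (K.rank x) = x) (hS : Φ ∈ S)
    (hadj : ∀ Ω ∈ S, Ω.elt (K.rank x) = x → ∀ i, i ≠ K.rank x → Ω.adj i ∈ S) : Ψ ∈ S := by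
  have step : ∀ {Ω Λ : K.Flag} {i : Fin 3}, Ω ∈ S → Ω.elt (K.rank x) = x → i ≠ K.rank x →
      (∀ j, j ≠ i → Λ.elt j = Ω.elt j) → Λ ∈ S := by
    intro Ω Λ i hΩ hx hi h
    rcases eq_or_eq_adj h with rfl | rfl
    · exact hΩ
    · exact hadj _ hΩ hx i hi
  -- Links of edges are not assumed connected; around an edge one can change the vertex and then the
  -- face.
  by_cases hx : K.rank x = 1
  · rw [hx] at hΦ hΨ step
    have hv := Ψ.incident 0 1
    rw [hΨ] at hv
    have hinc : ∀ j, j ≠ 0 → Incident (Ψ.elt 0) (Φ.elt j) := fun j hj => by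
      obtain rfl | rfl : j = 1 ∨ j = 2 := by revert j; decide
      · rwa [hΦ]
      · exact incident_trans (Ψ.rank_elt 0) hx (Φ.rank_elt 2) hv (hΦ ▸ Φ.incident 1 2)
    have h1 : Φ.replace 0 (Ψ.elt 0) (Ψ.rank_elt 0) hinc ∈ S :=
      step (i := 0) hS hΦ (by decide) fun j hj => by simp [replace, hj]
    refine step (i := 2) h1 (by simpa [replace] using hΦ) (by decide) fun j hj => ?_
    obtain rfl | rfl : j = 0 ∨ j = 1 := by revert j; decide
    · simp [replace]
    · simp [replace, hΨ, hΦ]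
  · have hx' : K.rank x = 0 ∨ K.rank x = 2 := by
      revert hx
      generalize K.rank x = a
      revert a
      decide
    have third : ∀ {Ω Λ : K.Flag} {y : P}, Ω ∈ S → Ω.elt (K.rank x) = x → Λ.elt (K.rank x) = x →
        K.rank y ≠ K.rank x → Ω.elt (K.rank y) = y → Λ.elt (K.rank y) = y → Λ ∈ S := by
      intro Ω Λ y hΩ hΩx hΛx hr hΩy hΛy
      obtain ⟨i, hi, hcov⟩ : ∃ i, i ≠ K.rank x ∧
          ∀ j, j ≠ i → j = K.rank x ∨ j = K.rank y := by
        revert hr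
        generalize K.rank x = a
        generalize K.rank y = b
        revert a b
        decide
      refine step hΩ hΩx hi fun j hj => ?_
      rcases hcov j hj with rfl | rfl
      · rw [hΩx, hΛx]
      · rw [hΩy, hΛy]
    have hedge : ∀ Ω : K.Flag, Ω.elt (K.rank x) = x →
        Ω.elt 1 ∈ (incidenceGraph P).neighborSet x := fun Ω hΩ => by
      have hr : K.rank x ≠ K.rank (Ω.elt 1) := by rw [Ω.rank_elt]; exact hx
      exact ⟨ne_of_rank_ne hr, hΩ ▸ Ω.incident (K.rank x) 1⟩
    -- The property carried along a walk in the link: all flags through x and the current neighbour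
    -- lie in S. Consecutive neighbours share a flag with x, and flags sharing two elements are
    -- equal or adjacent.
    have walk : ∀ y y' : (incidenceGraph P).neighborSet x,
        ((incidenceGraph P).induce ((incidenceGraph P).neighborSet x)).Walk y y' →
        (∀ Ω : K.Flag, Ω.elt (K.rank x) = x → Ω.elt (K.rank y.1) = y.1 → Ω ∈ S) →
        ∀ Ω : K.Flag, Ω.elt (K.rank x) = x → Ω.elt (K.rank y'.1) = y'.1 → Ω ∈ S := by
      intro y y' w
      induction w with
      | nil => exact fun h => h
      | @cons y y₁ _ hyy _ ih =>
        refine fun h => ih fun Λ hΛx hΛy => ?_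
        have hyy' : (incidenceGraph P).Adj y.1 y₁.1 := hyy
        have hy : (incidenceGraph P).Adj x y.1 := y.2
        have hy₁ : (incidenceGraph P).Adj x y₁.1 := y₁.2
        obtain ⟨Ω, h1, h2, h3⟩ := exists_flag_of_triple (K := K) hy.1 hy₁.1 hyy'.1 hy.2 hy₁.2
          hyy'.2
        exact third (h Ω h1 h2) h1 hΛx
          (fun e => hy₁.1 (eq_of_incident_of_rank_eq hy₁.2 e.symm)) h3 hΛy
    obtain ⟨w⟩ := (K.link_connected x hx').preconnected ⟨_, hedge Φ hΦ⟩ ⟨_, hedge Ψ hΨ⟩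
    refine walk _ _ w (fun Ω h1 h2 => third hS hΦ h1 ?_ ?_ h2) Ψ hΨ ?_
    · rw [Φ.rank_elt]; exact Ne.symm hx
    · rw [Φ.rank_elt]
    · rw [Ψ.rank_elt]

/-- Being fixed passes to adjacent flags, hence to all flags through a common element, and
connectedness of the incidence graph spreads it to every element. -/
theorem eq_one_of_smul_eq {φ : P ≃o P} {Φ : K.Flag} (h : φ • Φ = Φ) : φ = 1 := by
  have walk : ∀ x y, (incidenceGraph P).Walk x y →
      (∃ Ψ : K.Flag, Ψ.elt (K.rank x) = x ∧ φ • Ψ = Ψ) →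
      ∃ Ψ : K.Flag, Ψ.elt (K.rank y) = y ∧ φ • Ψ = Ψ := by
    intro x y w
    induction w with
    | nil => exact fun h => h
    | @cons x y _ hxy _ ih =>
      rintro ⟨Ψ, h1, h2⟩
      obtain ⟨Ω, h3, h4⟩ := exists_flag_of_incident (K := K) hxy.1 hxy.2
      refine ih ⟨Ω, h4, ?_⟩
      exact mem_of_adj_closed (S := {Ψ : K.Flag | φ • Ψ = Ψ}) h1 h3 h2
        fun Λ hΛ _ i _ => by
          rw [Set.mem_ofPred_eq] at hΛ ⊢
          rw [smul_adj, hΛ]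
  ext x
  obtain ⟨w⟩ := K.connected.preconnected (Φ.elt 0) x
  obtain ⟨Ψ, h1, h2⟩ := walk _ _ w ⟨Φ, by rw [Φ.rank_elt], h⟩
  rw [← h1, ← smul_elt, h2]
  rfl

end Flag

end AbstractPolyhedron

theorem natCard_eq_of_enatCard_eq {α : Type*} {n : ℕ} (h : ENat.card α = n) :
    Nat.card α = n := by
  have : Finite α := by
    rw [← ENat.card_lt_top, h]
    exact ENat.natCast_lt_top n
  rw [ENat.card_eq_coe_natCard] at h
  exact_mod_cast h

namespace AbstractPolyhedron

variable {P : Type*} [PartialOrder P] {K : AbstractPolyhedron P}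

open AbstractPolyhedron.Flag

/-! ### Rotations of chiral polyhedra -/

theorem not_smul_eq_adj (hK : K.IsChiral) (φ : P ≃o P) (Φ : K.Flag) (i : Fin 3) :
    φ • Φ ≠ Φ.adj i := by
  obtain ⟨C, horb, -, hadj⟩ := hK
  intro h
  have h1 := (horb Φ (Φ.adj i)).1 ⟨φ, sends_iff.2 h⟩
  have h2 := hadj i Φ _ (adjacentAt_adj i Φ)
  tauto

theorem exists_smul_eq_adj_adj (hK : K.IsChiral) (Φ : K.Flag) (i j : Fin 3) :
    ∃ φ : P ≃o P, φ • Φ = (Φ.adj i).adj j := by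
  obtain ⟨C, horb, -, hadj⟩ := hK
  have h1 := hadj i Φ _ (adjacentAt_adj i Φ)
  have h2 := hadj j _ _ (adjacentAt_adj j (Φ.adj i))
  obtain ⟨φ, hφ⟩ := (horb Φ ((Φ.adj i).adj j)).2 (by tauto)
  exact ⟨φ, sends_iff.1 hφ⟩

theorem IsChiral.nonempty_flag (hK : K.IsChiral) : Nonempty K.Flag := by
  obtain ⟨C, -, hnt, -⟩ := hK
  by_contra h
  rw [not_nonempty_iff] at h
  exact hnt fun Φ => h.elim Φ

/-- The image of the flag is the flag itself or an adjacent one, and chirality excludes the latter.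
-/
theorem eq_one_of_agree (hK : K.IsChiral) {φ : P ≃o P} {Φ : K.Flag} (i : Fin 3)
    (h : ∀ j, j ≠ i → φ (Φ.elt j) = Φ.elt j) : φ = 1 :=
  eq_one_of_smul_eq ((eq_or_eq_adj (Ψ := φ • Φ) h).resolve_right (not_smul_eq_adj hK φ Φ i))

/-- A rotation about a vertex or face acts transitively on the pairs of adjacent flags there. -/
theorem exists_zpow_smul {Φ Ψ : K.Flag} {i j k : Fin 3} (hik : i ≠ k) (hjk : j ≠ k)
    (hij : i ≠ j) {σ : P ≃o P} (hσ : σ • Φ = (Φ.adj i).adj j) (hΨ : Ψ.elt k = Φ.elt k) :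
    ∃ n : ℤ, Ψ = σ ^ n • Φ ∨ Ψ = σ ^ n • Φ.adj i := by
  have hr : K.rank (Φ.elt k) = k := Φ.rank_elt k
  refine mem_of_adj_closed (S := {Ψ : K.Flag | ∃ n : ℤ, Ψ = σ ^ n • Φ ∨ Ψ = σ ^ n • Φ.adj i})
    (x := Φ.elt k) (by rw [hr]) (by rw [hr, hΨ]) ⟨0, Or.inl (by simp)⟩ ?_
  rintro Ω ⟨n, hn⟩ - l hl
  rw [hr] at hl
  have hl' : l = i ∨ l = j := by
    clear * - hik hjk hij hl
    revert i j k l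
    decide
  -- This closes up the cycle of flags around the k-element: the j-neighbour of Φ is the i-neighbour
  -- turned back once.
  have hΦj : Φ.adj j = σ⁻¹ • Φ.adj i := by
    rw [eq_inv_smul_iff, smul_adj, hσ, adj_adj]
  rcases hl' with rfl | rfl <;> rcases hn with rfl | rfl
  · exact ⟨n, Or.inr (smul_adj _ _ _).symm⟩
  · exact ⟨n, Or.inl (by rw [← smul_adj, adj_adj])⟩
  · exact ⟨n - 1, Or.inr (by rw [← smul_adj, hΦj, smul_smul, zpow_sub_one])⟩
  · exact ⟨n + 1, Or.inl (by rw [← smul_adj, ← hσ, smul_smul, zpow_add_one])⟩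

/-- The powers of σ correspond bijectively to the edges at the k-element. The hypothesis `hm`
ensures that the edges of both flag families in `exists_zpow_smul` form one orbit: m = 1 for `σ₁`,
where i = 1 changes the edge, and m = 0 for `σ₂`. -/
theorem orderOf_rotation (hK : K.IsChiral) {Φ : K.Flag} {i j k : Fin 3} (hik : i ≠ k)
    (hjk : j ≠ k) (hij : i ≠ j) (hk : k ≠ 1) {σ : P ≃o P} (hσ : σ • Φ = (Φ.adj i).adj j)
    {m : ℤ} (hm : (Φ.adj i).elt 1 = (σ ^ m • Φ).elt 1) {n : ℕ}
    (hn : {e | K.rank e = 1 ∧ Incident e (Φ.elt k)}.encard = n) : orderOf σ = n := by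
  have hfix : ∀ g ∈ Subgroup.zpowers σ, g (Φ.elt k) = Φ.elt k := by
    have hσk : σ ∈ MulAction.stabilizer (P ≃o P) (Φ.elt k) := by
      rw [MulAction.mem_stabilizer_iff]
      show (σ • Φ).elt k = Φ.elt k
      rw [hσ, adj_elt _ hjk.symm, adj_elt _ hik.symm]
    exact fun g hg => Subgroup.zpowers_le.2 hσk hg
  let f : Subgroup.zpowers σ → {e | K.rank e = 1 ∧ Incident e (Φ.elt k)} := fun g =>
    ⟨g.1 (Φ.elt 1), by rw [rank_map, Φ.rank_elt],
      hfix g.1 g.2 ▸ (Φ.incident 1 k).map g.1⟩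
  have hf : Function.Bijective f := by
    constructor
    · rintro ⟨g, hg⟩ ⟨g', hg'⟩ h
      have h1 : g (Φ.elt 1) = g' (Φ.elt 1) := congrArg Subtype.val h
      have hcov : ∃ l : Fin 3, ∀ j, j ≠ l → j = 1 ∨ j = k := by
        revert hk
        clear * -
        revert k
        decide
      obtain ⟨l, hl⟩ := hcov
      have : g⁻¹ * g' = 1 := by
        refine eq_one_of_agree hK (Φ := Φ) l fun j hj => ?_
        rcases hl j hj with rfl | rfl
        · show g.symm (g' _) = _
          rw [← h1, OrderIso.symm_apply_apply]
        · exact hfix _ (Subgroup.mul_mem _ (Subgroup.inv_mem _ hg) hg')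
      exact Subtype.ext (inv_mul_eq_one.1 this)
    · rintro ⟨e, he, hinc⟩
      have hne : e ≠ Φ.elt k := ne_of_rank_ne (K := K) (by rw [he, Φ.rank_elt]; exact hk.symm)
      obtain ⟨Ψ, h1, h2⟩ := exists_flag_of_incident (K := K) hne hinc
      rw [he] at h1
      rw [Φ.rank_elt] at h2
      obtain ⟨l, rfl | rfl⟩ := exists_zpow_smul hik hjk hij hσ h2
      · exact ⟨⟨σ ^ l, l, rfl⟩, Subtype.ext h1⟩
      · refine ⟨⟨σ ^ (l + m), l + m, rfl⟩, Subtype.ext ?_⟩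
        show (σ ^ (l + m) • Φ).elt 1 = e
        rw [zpow_add, mul_smul, smul_elt, ← hm, ← h1, smul_elt]
  have hcard := ENat.card_congr (Equiv.ofBijective f hf)
  rw [ENat.card_coe_set_eq, hn] at hcard
  rw [← Nat.card_zpowers, natCard_eq_of_enatCard_eq hcard]

/-- The orbits of a flag and of an adjacent flag are disjoint, and each is a copy of the
automorphism group. -/
theorem natCard_automorphisms_le (hK : K.IsChiral) [Finite K.Flag] :
    Finite (P ≃o P) ∧ 2 * Nat.card (P ≃o P) ≤ Nat.card K.Flag := by
  obtain ⟨Φ⟩ := hK.nonempty_flag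
  have hinj : ∀ (Ψ : K.Flag) (g g' : P ≃o P), g • Ψ = g' • Ψ → g = g' := fun Ψ g g' h => by
    have : g⁻¹ * g' = 1 := eq_one_of_smul_eq (Φ := Ψ) (by rw [mul_smul, ← h, inv_smul_smul])
    exact inv_mul_eq_one.1 this
  have hne : ∀ g g' : P ≃o P, g • Φ ≠ g' • Φ.adj 0 := fun g g' h => by
    apply not_smul_eq_adj hK (g'⁻¹ * g) Φ 0
    rw [mul_smul, h, inv_smul_smul]
  have hf : Function.Injective
      (Sum.elim (fun g : P ≃o P => g • Φ) (fun g : P ≃o P => g • Φ.adj 0)) := by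
    rintro (g | g) (g' | g') h
    · exact congrArg _ (hinj _ _ _ h)
    · exact (hne _ _ h).elim
    · exact (hne _ _ h.symm).elim
    · exact congrArg _ (hinj _ _ _ h)
  have hfin : Finite (P ≃o P) := Finite.of_injective _ (hinj Φ · · ·)
  refine ⟨hfin, ?_⟩
  have := Nat.card_le_card_of_injective _ hf
  rw [Nat.card_sum] at this
  omega

/-- The product of the two rotations is an involution. -/
theorem mul_mul_mul_eq_one (hK : K.IsChiral) {Φ : K.Flag} {σ₁ σ₂ : P ≃o P}
    (h₁ : σ₁ • Φ = (Φ.adj 1).adj 0) (h₂ : σ₂ • Φ = (Φ.adj 2).adj 1) :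
    (σ₁ * σ₂) * (σ₁ * σ₂) = 1 := by
  -- The conjugate `σ₂ * σ₁` is the half-turn about the base edge; its square fixes that edge and
  -- both end vertices.
  have hτ : (σ₂ * σ₁) • Φ = (Φ.adj 2).adj 0 := by
    rw [mul_smul, h₁, smul_adj, smul_adj, h₂, adj_adj]
  set τ := σ₂ * σ₁ with hτdef
  have he : τ (Φ.elt 1) = Φ.elt 1 := by
    rw [← smul_elt, hτ, adj_elt _ (by decide), adj_elt _ (by decide)]
  have hv : τ (Φ.elt 0) ≠ Φ.elt 0 := by
    rw [← smul_elt, hτ, ← adj_elt (i := 2) Φ (j := 0) (by decide)]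
    exact adj_elt_ne 0 _
  have hv2 : τ (τ (Φ.elt 0)) = Φ.elt 0 := by
    obtain ⟨x, y, hxy, hs⟩ := Set.encard_eq_two.1 (K.edge_vertices _ (Φ.rank_elt 1))
    have hstep : ∀ u, u ∈ {v | K.rank v = 0 ∧ Incident v (Φ.elt 1)} →
        τ u ∈ {v | K.rank v = 0 ∧ Incident v (Φ.elt 1)} := fun u hu =>
      ⟨by rw [rank_map]; exact hu.1, he ▸ hu.2.map τ⟩
    have m0 : Φ.elt 0 ∈ {v | K.rank v = 0 ∧ Incident v (Φ.elt 1)} :=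
      ⟨Φ.rank_elt 0, Φ.incident 0 1⟩
    have m1 := hstep _ m0
    have m2 := hstep _ m1
    have hne : τ (τ (Φ.elt 0)) ≠ τ (Φ.elt 0) := fun h => hv (τ.injective h)
    rw [hs] at m0 m1 m2
    simp only [Set.mem_insert_iff, Set.mem_singleton_iff] at m0 m1 m2
    grind
  have hττ : τ * τ = 1 := by
    refine eq_one_of_agree hK (Φ := Φ) 2 fun j hj => ?_
    obtain rfl | rfl : j = 0 ∨ j = 1 := by revert j; decide
    · exact hv2
    · show τ (τ _) = _
      rw [he, he]
  calc (σ₁ * σ₂) * (σ₁ * σ₂) = σ₁ * (τ * τ) * σ₁⁻¹ := by rw [hτdef]; group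
    _ = 1 := by rw [hττ]; group

theorem type_of_isDistinguishedPair {p q : ℕ} (htight : K.IsTightOfType p q)
    (hK : K.IsChiral) (hq : Odd q) {Φ : K.Flag} {σ₁ σ₂ : P ≃o P}
    (h₁ : σ₁ • Φ = (Φ.adj 1).adj 0) (h₂ : σ₂ • Φ = (Φ.adj 2).adj 1) :
    (Even p ∧ p ∣ 2 * q) ∧
      (IsCoreFree ((Subgroup.zpowers σ₂).subgroupOf (rotationGroup σ₁ σ₂)) → p = 2 * q) := by
  have hp₁ : orderOf σ₁ = p := by
    refine orderOf_rotation hK (k := 2) (by decide) (by decide) (by decide) (by decide) h₁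
      (m := 1) ?_ (htight.1.1 _ (Φ.rank_elt 2))
    rw [zpow_one, h₁, adj_elt (i := 0) _ (by decide)]
  have hq₂ : orderOf σ₂ = q := by
    refine orderOf_rotation hK (k := 0) (by decide) (by decide) (by decide) (by decide) h₂
      (m := 0) ?_ (htight.1.2 _ (Φ.rank_elt 0))
    rw [zpow_zero, one_smul, adj_elt (i := 2) _ (by decide)]
  have hflags : Nat.card K.Flag = 2 * p * q := natCard_eq_of_enatCard_eq htight.2
  have hfin : Finite K.Flag := by
    rw [← ENat.card_lt_top, htight.2]
    exact ENat.natCast_lt_top _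
  obtain ⟨hfinAut, hcard⟩ := natCard_automorphisms_le hK
  have hdisj : Disjoint (Subgroup.zpowers σ₁) (Subgroup.zpowers σ₂) := by
    rw [Subgroup.disjoint_def]
    intro g hg₁ hg₂
    have s₁ : σ₁ ∈ MulAction.stabilizer (P ≃o P) (Φ.elt 2) := by
      show (σ₁ • Φ).elt 2 = Φ.elt 2
      rw [h₁, adj_elt _ (by decide), adj_elt _ (by decide)]
    have s₂ : σ₂ ∈ MulAction.stabilizer (P ≃o P) (Φ.elt 0) := by
      show (σ₂ • Φ).elt 0 = Φ.elt 0
      rw [h₂, adj_elt _ (by decide), adj_elt _ (by decide)]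
    refine eq_one_of_agree hK (Φ := Φ) 1 fun j hj => ?_
    obtain rfl | rfl : j = 0 ∨ j = 2 := by revert j; decide
    · exact Subgroup.zpowers_le.2 s₂ hg₂
    · exact Subgroup.zpowers_le.2 s₁ hg₁
  have hne : σ₁ ≠ 1 := by
    rintro rfl
    rw [one_smul] at h₁
    apply adj_elt_ne 1 Φ
    conv_rhs => rw [h₁]
    rw [adj_elt (i := 0) _ (by decide)]
  have m₁ : σ₁ ∈ rotationGroup σ₁ σ₂ := Subgroup.subset_closure (by simp)
  have m₂ : σ₂ ∈ rotationGroup σ₁ σ₂ := Subgroup.subset_closure (by simp)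
  have hz : ∀ (σ : P ≃o P) (m : σ ∈ rotationGroup σ₁ σ₂),
      Subgroup.zpowers (⟨σ, m⟩ : rotationGroup σ₁ σ₂) =
        (Subgroup.zpowers σ).subgroupOf (rotationGroup σ₁ σ₂) := fun σ m => by
    ext ⟨g, hg⟩
    simp only [Subgroup.mem_subgroupOf, Subgroup.mem_zpowers_iff, Subtype.ext_iff,
      Subgroup.coe_zpow]
  have key := orderOf_of_card_le_mul (a := (⟨σ₁, m₁⟩ : rotationGroup σ₁ σ₂)) (b := ⟨σ₂, m₂⟩)
    (Subtype.ext (mul_mul_mul_eq_one hK h₁ h₂)) (by rwa [Subgroup.orderOf_mk, hq₂])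
    (fun h => hne (congrArg Subtype.val h))
    (by
      rw [Subgroup.disjoint_def]
      intro g hg₁ hg₂
      rw [hz, Subgroup.mem_subgroupOf] at hg₁ hg₂
      exact Subtype.ext (Subgroup.disjoint_def.1 hdisj hg₁ hg₂))
    (by
      rw [Subgroup.orderOf_mk, Subgroup.orderOf_mk, hp₁, hq₂]
      refine (Subgroup.card_le_card_group _).trans ?_
      rw [hflags, mul_assoc] at hcard
      omega)
  rw [Subgroup.orderOf_mk, Subgroup.orderOf_mk, hp₁, hq₂, hz] at key
  exact key

end AbstractPolyhedron

theorem mainTheorem4 {P : Type*} [PartialOrder P] (K : AbstractPolyhedron P) (p q : ℕ)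
    (htight : K.IsTightOfType p q) (hchiral : K.IsChiral) (hq : Odd q) :
    (Even p ∧ p ∣ 2 * q) ∧
      ∀ (Φ : K.Flag) (σ₁ σ₂ : P ≃o P), K.IsDistinguishedPair Φ σ₁ σ₂ →
        IsCoreFree ((Subgroup.zpowers σ₂).subgroupOf (rotationGroup σ₁ σ₂)) → p = 2 * q := by
  open AbstractPolyhedron in
  constructor
  · obtain ⟨Φ⟩ := hchiral.nonempty_flag
    obtain ⟨σ₁, h₁⟩ := exists_smul_eq_adj_adj hchiral Φ 1 0
    obtain ⟨σ₂, h₂⟩ := exists_smul_eq_adj_adj hchiral Φ 2 1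
    exact (type_of_isDistinguishedPair htight hchiral hq h₁ h₂).1
  · rintro Φ σ₁ σ₂ ⟨⟨Ψ, Ω, a1, a2, a3⟩, ⟨Ψ', Ω', b1, b2, b3⟩⟩
    refine (type_of_isDistinguishedPair (Φ := Φ) htight hchiral hq ?_ ?_).2
    · rw [Flag.sends_iff.1 a3, a2.eq_adj, a1.eq_adj]
    · rw [Flag.sends_iff.1 b3, b2.eq_adj, b1.eq_adj]
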